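/- **Setting.** Let $V$ be a finite set of parties and $G\subseteq V\times V$ a digraph; an arc $(u,v)$ is a proposed transfer of one asset from $u$ to $v$. For a set $\alpha$ of arcs write $\mathrm{in}_x(\alpha)$, $\mathrm{out}_x(\alpha)$ for its arcs entering and leaving $x$. Each party $x$ has, for every outgoing arc $\gamma$, an income predicate $I_x^\gamma$ on sets of incoming arcs, monotone under inclusion, and a predicate $O_x$ on sets of outgoing arcs that holds for $\emptyset$ and is inherited by subsets ($x$ does not overpay). The safety and liveness predicates of $x$ are $$S_x(\alpha)=\bigwedge_{\gamma\in \mathrm{out}_x(G)}\bigl(\gamma\in\alpha\Rightarrow I_x^\gamma(\mathrm{in}_x(\alpha))\bigr)\wedge O_x(\mathrm{out}_x(\alpha)),\qquad L_x(\alpha)=S_x(\alpha)\wedge\bigvee_{\gamma\in \mathrm{out}_x(G)}I_x^\gamma(\mathrm{in}_x(\alpha)).$$ A *solution* is a nonempty strongly connected $s\subseteq G$ with $S_x(s)$ true for all $x$; $V_s$ is the set of endpoints of arcs of $s$. **Market clearing.** Let $S$ be any set of solutions. $T(S)$ is the graph with an arc $s\to s'$ when $s\subsetneq s'$ and no member of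 $S$ lies strictly in between; roots and leaves of $T(S)$ are the minimal and maximal members of $S$. A party $x$ is a *redundancy provider* if there are solutions in $S$, all involving $x$, whose union makes $S_x$ false. For each *layer* $s\setminus b$, where $s$ is a root and $b=\emptyset$, or $b\to s$ is an arc of $T(S)$, a set of *leaders* is chosen: a feedback vertex set of $s\setminus b$, empty if $s\setminus b$ is acyclic. Each leader of the layer, and each redundancy provider that is an endpoint of an arc of $s\setminus b$, generates one new secret for this layer, and the secret's hash is a new hashlock; $\mathcal N(b,s)$ is the set of these hashlocks. For each path $q=[s_0,\dots,s_k]$ of $T(S)$ from a root to a leaf put $\mathcal H_{s_0,q}=\mathcal N(\emptyset,s_0)$ and $\mathcal H_{s_i,q}=\mathcal H_{s_{i-1},q}\cup\mathcal N(s_{i-1},s_i)$. Each pair $(s_i,q)$ is a *scheme*; a party is a leader in it if it is a leader in one of the layers up to $s_i$ on $q$. **Contracts.** Time is discrete, and $\Delta>0$ bounds the time to issue a transaction and have it confirmed and visible. During the escrow phase, and at no other time, the owner $u$ of the asset on an arc $(u,v)$ may escrow it under a conjunction of hashlocks, and may join further conjunctions to the circuit by OR. A hashkey for a hashlock $h$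 on $(u,v)$ is (secret of $h$, path, path signature), the path $(u_0,\dots,u_k)$ being a path of $G$ without repeated vertices from $u_0=v$ to the generator $u_k$ of $h$, and the signature $sig(\cdots sig(sig(\text{secret},u_k),u_{k-1})\cdots,u_0)$. The contract accepts it, unlocking $h$ on this arc, if $h$ occurs in the circuit and at most $(k+1)\Delta$ has passed since the start of the redeem phase. An arc is triggered (its asset is paid) when all hashlocks of one of the conjunctions of its circuit are unlocked on it; otherwise the asset is refunded in the end. **Conforming party $x$ in ProtocolA.** The escrow phase ends before the redeem phase starts; all schemes are run in parallel. * *Escrow:* for each scheme $(s,q)$, $x$ escrows its outgoing arcs of $s$ under $\bigwedge\mathcal H_{s,q}$ (by OR, if they are already escrowed), at once if it is a leader in the scheme, and otherwise only after all its incoming arcs of $s$ have been escrowed under $\bigwedge\mathcal H_{s,q}$; it does so within $\Delta$ of being allowed to, if the phase lasts that long, and makes no other escrows. * *Select:* the set $S_c$ consists of the finally proposed schemes for which all redundancy providers vote yes. If $x$ is a redundancy provider, then the finally proposed schemes for which it votes yes are compatible: the union of their digraphs makes $S_y$ true for every party $y$. * *Redeem:* $x$ proceeds with a scheme of $S_c$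 only if, for each hashlock $h$ in it that $x$ generated and each scheme $(s',q')$ with $h\in\mathcal H_{s',q'}$, all incoming arcs of $x$ in $s'$ were escrowed under $\bigwedge\mathcal H_{s',q'}$ in the escrow phase. It releases exactly those of its secrets that belong to schemes with which it proceeds, by sending the hashkey with path $(x)$, within $\Delta$, to all its incoming arcs with that hashlock. When a hashkey with path $p\not\ni x$ is accepted on an outgoing arc of $x$, then $x$ within $\Delta$ (counted from the start of the redeem phase if acceptance is earlier) sends the hashkey with path $x\|p$ and $x$'s signature added to each of its incoming arcs that has this hashlock, unless it is unlocked already. It sends no other hashkeys. All other parties may behave arbitrarily and collude: they may submit any transactions and cast any votes, except that no one can forge $x$'s signature. **Theorem.** *In ProtocolA, a conforming party is always safe.* In every execution in which $x$ conforms, let $\omega\subseteq G$ be the set of arcs that are eventually triggered. If some outgoing arc of $x$ belongs to $\omega$, then $L_x(\omega)$ is true; and in every case $S_x(\omega)$ is true, so in particular $x$ does not overpay: $O_x(\mathrm{out}_x(\omega))$. -/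

import Mathlib

namespace ProtocolA

/-! ### Digraphs, requirements and solutions -/

/-- An arc `(u, v)` is a proposed transfer of one asset from party `u` to party `v`. -/
abbrev Arc (V : Type*) := V × V

/-- A digraph, given by its arcs.  An assignment of Booleans to arcs is identified with the
set of arcs that it makes true, so assignments and swap digraphs have this type as well. -/
abbrev Digr (V : Type*) := Set (Arc V)

section Digraphs

variable {V : Type*}

/-- The vertices of a digraph: the endpoints of its arcs. -/
def verts (D : Digr V) : Set V := {v | ∃ a ∈ D, a.1 = v ∨ a.2 = v}

/-- The arcs of `D` entering `x`. -/
def inc (D : Digr V) (x : V) : Set (Arc V) := {a ∈ D | a.2 = x}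

/-- The arcs of `D` leaving `x`. -/
def out (D : Digr V) (x : V) : Set (Arc V) := {a ∈ D | a.1 = x}

/-- From every vertex there is a path to every other vertex. -/
def StronglyConnected (D : Digr V) : Prop :=
  ∀ u ∈ verts D, ∀ v ∈ verts D, Relation.ReflTransGen (fun a b => (a, b) ∈ D) u v

/-- No directed cycle. -/
def Acyclic (D : Digr V) : Prop :=
  ∀ v, ¬ Relation.TransGen (fun a b => (a, b) ∈ D) v v

/-- A feedback vertex set: vertices of `D` whose removal leaves no cycle. -/
def IsFVS (D : Digr V) (L : Set V) : Prop :=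
  L ⊆ verts D ∧ Acyclic {a ∈ D | a.1 ∉ L ∧ a.2 ∉ L}

end Digraphs

/-- What one party requires.  `income γ` is the income predicate attached to the outgoing
asset `γ`, read on the set of incoming arcs that take place; `cap` is the predicate on the set
of outgoing arcs that take place which says that the party does not overpay.  Receiving more
and paying less is never worse, and paying nothing is not overpaying. -/
structure Requirement (V : Type*) where
  income : Arc V → Set (Arc V) → Prop
  cap : Set (Arc V) → Prop
  income_mono : ∀ γ X Y, X ⊆ Y → income γ X → income γ Y
  cap_anti : ∀ X Y, X ⊆ Y → cap Y → cap X
  cap_empty : cap ∅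

section Predicates

variable {V : Type*}

/-- The safety predicate `S_x` of party `x` in `G`, under the assignment `α`. -/
def Safe (G : Digr V) (r : Requirement V) (x : V) (α : Digr V) : Prop :=
  (∀ γ ∈ out G x, γ ∈ α → r.income γ (inc α x)) ∧ r.cap (out α x)

/-- The liveness predicate `L_x`: safety, and one of the income predicates holds. -/
def Live (G : Digr V) (r : Requirement V) (x : V) (α : Digr V) : Prop :=
  Safe G r x α ∧ ∃ γ ∈ out G x, r.income γ (inc α x)

/-- A solution: a nontrivial assignment satisfying every party's predicate, whose swap
digraph is strongly connected. -/
structure IsSolution (G : Digr V) (req : V → Requirement V) (s : Digr V) : Prop where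
  subset : s ⊆ G
  nonempty : s.Nonempty
  connected : StronglyConnected s
  safe : ∀ x, Safe G (req x) x s

/-- The arcs of the graph `T(S)`: `s'` properly includes `s`, with no member of `S` strictly
in between. -/
def Covers (S : Set (Digr V)) (s s' : Digr V) : Prop :=
  s ∈ S ∧ s' ∈ S ∧ s ⊂ s' ∧ ∀ r ∈ S, ¬ (s ⊂ r ∧ r ⊂ s')

/-- Roots of `T(S)`. -/
def IsRoot (S : Set (Digr V)) (s : Digr V) : Prop := s ∈ S ∧ ∀ r ∈ S, ¬ r ⊂ s

/-- Leaves of `T(S)`. -/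
def IsLeaf (S : Set (Digr V)) (s : Digr V) : Prop := s ∈ S ∧ ∀ r ∈ S, ¬ s ⊂ r

/-- `Layer S b s`: hashlocks are generated for the arcs `s \ b`.  Either `s` is a root, where
`b = ∅`, or `b → s` is an arc of `T(S)`. -/
def Layer (S : Set (Digr V)) (b s : Digr V) : Prop :=
  (b = ∅ ∧ IsRoot S s) ∨ Covers S b s

end Predicates

/-- The outcome of market clearing: a predicated digraph, the set of solutions that was found
(not necessarily all of them), and, for each layer `s \ b`, the chosen leaders: a feedback
vertex set, empty if the layer is acyclic. -/
structure Market (V : Type*) where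
  G : Digr V
  req : V → Requirement V
  sols : Set (Digr V)
  leaders : Digr V → Digr V → Set V
  sols_valid : ∀ s ∈ sols, IsSolution G req s
  leaders_fvs : ∀ b s, Layer sols b s → IsFVS (s \ b) (leaders b s)
  leaders_acyclic : ∀ b s, Layer sols b s → Acyclic (s \ b) → leaders b s = ∅

/-! ### Secrets, hashlocks and swap schemes -/

/-- The random secret chosen by `owner` for the layer `target \ base`. -/
structure Secret (V : Type*) where
  owner : V
  base : Digr V
  target : Digr V

/-- Hash values.  The hash function is the constructor `Hashlock.hash`: in this symbolic model
it is free of collisions, and a hash value does not reveal the secret to a party. -/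
structure Hashlock (V : Type*) where hash ::
  preimage : Secret V

/-- A swap scheme `(s, q)`: a path `q` of `T(S)` and the position of `s` on it. -/
structure Scheme (V : Type*) where
  path : List (Digr V)
  idx : ℕ

section Schemes

variable {V : Type*}

/-- The solution at position `i` of a path. -/
def solAt (q : List (Digr V)) (i : ℕ) : Digr V := q.getD i ∅

/-- The solution before position `i`, and `∅` at the root. -/
def prevAt (q : List (Digr V)) : ℕ → Digr V
  | 0 => ∅
  | i + 1 => solAt q i

/-- The swap digraph of a scheme. -/
def Scheme.graph (σ : Scheme V) : Digr V := solAt σ.path σ.idx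

/-- The union of the swap digraphs of a set of schemes. -/
def unionGraph (C : Set (Scheme V)) : Digr V := ⋃ σ ∈ C, σ.graph

namespace Market

variable (M : Market V)

/-- Redundancy providers: `x` takes part in each of several solutions, and completing all of
these makes `P_x` false.  For a family `{s₁, s₂}` this says that `s₁` and `s₂` conflict at
`x`. -/
def RedundancyProvider (x : V) : Prop :=
  ∃ F ⊆ M.sols, (∀ s ∈ F, x ∈ verts s) ∧ ¬ Safe M.G (M.req x) x (⋃₀ F)

/-- The hashlock generators of the layer `s \ b`: leaders and redundancy providers in it. -/
def generators (b s : Digr V) : Set V :=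
  M.leaders b s ∪ {x ∈ verts (s \ b) | M.RedundancyProvider x}

/-- The hashlocks generated for the layer `s \ b`, one by each generator. -/
def newLocks (b s : Digr V) : Set (Hashlock V) :=
  {h | ∃ x ∈ M.generators b s, h = Hashlock.hash ⟨x, b, s⟩}

/-- The hashlock sets along a path: each solution reuses those of its predecessor. -/
def locksAt (q : List (Digr V)) : ℕ → Set (Hashlock V)
  | 0 => M.newLocks ∅ (solAt q 0)
  | i + 1 => locksAt q i ∪ M.newLocks (solAt q i) (solAt q (i + 1))

/-- The hashlock set `H_{s,q}` of a scheme.  Its circuit is the conjunction of this set. -/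
def locks (σ : Scheme V) : Set (Hashlock V) := M.locksAt σ.path σ.idx

/-- The paths of `T(S)` from a root to a leaf. -/
def IsPath (q : List (Digr V)) : Prop :=
  q ≠ [] ∧ q.IsChain (Covers M.sols) ∧
    (∀ s ∈ q.head?, IsRoot M.sols s) ∧ (∀ s ∈ q.getLast?, IsLeaf M.sols s)

/-- The schemes that are run in parallel. -/
def schemes : Set (Scheme V) := {σ | M.IsPath σ.path ∧ σ.idx < σ.path.length}

/-- `x` is a leader in the scheme: it was chosen as a leader in one of its layers. -/
def IsLeaderIn (x : V) (σ : Scheme V) : Prop :=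
  ∃ j ≤ σ.idx, x ∈ M.leaders (prevAt σ.path j) (solAt σ.path j)

/-- A set of schemes without conflicts: all of them can be completed together without
violating the predicate of any party. -/
def Compatible (C : Set (Scheme V)) : Prop :=
  ∀ y, Safe M.G (M.req y) y (unionGraph C)

end Market

end Schemes

/-! ### Hashkeys -/

/-- Signed messages: a secret, or `sig m u`, the message `m` signed by `u`. -/
inductive Msg (V : Type*) where
  | secret : Secret V → Msg V
  | sig : Msg V → V → Msg V

/-- The path signature `sig (… sig (sig θ u_k) u_{k-1} …) u_0` of the path `u_0, …, u_k`. -/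
def pathSig {V : Type*} (θ : Secret V) : List V → Msg V
  | [] => Msg.secret θ
  | u :: p => Msg.sig (pathSig θ p) u

/-- `Occurs m m'`: the message `m` is part of the message `m'`. -/
def Occurs {V : Type*} (m : Msg V) : Msg V → Prop
  | Msg.secret θ => m = Msg.secret θ
  | Msg.sig m' u => m = Msg.sig m' u ∨ Occurs m m'

/-- A triple sent to a contract as a hashkey; it need not be well formed. -/
structure Hashkey (V : Type*) where
  secret : Secret V
  path : List V
  sigma : Msg V

section Keys

variable {V : Type*}

/-- The key is well formed for the arc `a = (u, v)` of `G`: its path is a path of `G` without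
repeated vertices from `v` to the party who chose the secret, and its path signature is valid. -/
def Hashkey.WellFormed (G : Digr V) (a : Arc V) (k : Hashkey V) : Prop :=
  k.path.IsChain (fun u v => (u, v) ∈ G) ∧ k.path.Nodup ∧
    k.path.head? = some a.2 ∧ k.path.getLast? = some k.secret.owner ∧
    k.sigma = pathSig k.secret k.path

/-- The hashkey by which `x` releases its secret `θ`. -/
def releaseKey (x : V) (θ : Secret V) : Hashkey V :=
  ⟨θ, [x], Msg.sig (Msg.secret θ) x⟩

/-- The hashkey that `x` makes out of a hashkey `k` received on an outgoing arc. -/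
def relayKey (x : V) (k : Hashkey V) : Hashkey V :=
  ⟨k.secret, x :: k.path, Msg.sig k.sigma x⟩

end Keys

/-! ### Executions and contracts -/

/-- Transactions: the owner of arc `a` escrows the asset, if it is not escrowed yet, and joins
the conjunction of the hashlock set `C` to the circuit by an OR gate; or a hashkey is sent to
the contract of `a`. -/
inductive Tx (V : Type*) where
  | escrow : Arc V → Set (Hashlock V) → Tx V
  | hashkey : Arc V → Hashkey V → Tx V

/-- The time table: `Δ` bounds the time from issuing a transaction to its being confirmed and
visible to all; the escrow phase ends at `escrowEnd`; after the select phase, the redeem phase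
starts at `redeemStart`. -/
structure Timing where
  Δ : ℕ
  escrowEnd : ℕ
  redeemStart : ℕ
  Δ_pos : 0 < Δ
  escrowEnd_le : escrowEnd ≤ redeemStart

/-- What the parties do, without any restriction.  `log t y` is the set of transactions of
party `y` that are confirmed at time `t`; `proposal` is the set of schemes finally proposed in
the select phase; `votes y` is the set of schemes for which `y` votes yes. -/
structure Execution (V : Type*) where
  log : ℕ → V → Set (Tx V)
  proposal : Set (Scheme V)
  votes : V → Set (Scheme V)

namespace Execution

variable {V : Type*} (M : Market V) (T : Timing) (E : Execution V)

/-- The circuit on arc `a` at time `t`, as the set of the conjunctions joined by OR.  Only the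
owner of the asset can extend it, and only during the escrow phase. -/
def circuit (a : Arc V) (t : ℕ) : Set (Set (Hashlock V)) :=
  {C | ∃ t' ≤ t, t' ≤ T.escrowEnd ∧ Tx.escrow a C ∈ E.log t' a.1}

/-- At time `t` the contract on arc `a` receives and accepts the hashkey `k`: the key is well
formed, its hashlock occurs in the circuit, and it has not timed out.  A hashkey of a path
with `n` vertices times out `n * Δ` after the start of the redeem phase. -/
def Accepts (a : Arc V) (k : Hashkey V) (t : ℕ) : Prop :=
  (∃ y, Tx.hashkey a k ∈ E.log t y) ∧ a ∈ M.G ∧ k.WellFormed M.G a ∧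
    (∃ C ∈ E.circuit T a t, Hashlock.hash k.secret ∈ C) ∧
    t ≤ T.redeemStart + k.path.length * T.Δ

/-- The hashlock `h` on arc `a` has been unlocked by time `t`. -/
def Unlocked (a : Arc V) (h : Hashlock V) (t : ℕ) : Prop :=
  ∃ t' ≤ t, ∃ k, E.Accepts M T a k t' ∧ Hashlock.hash k.secret = h

/-- The circuit of arc `a` is true at time `t`: some conjunction in it has been unlocked. -/
def TriggeredAt (a : Arc V) (t : ℕ) : Prop :=
  ∃ C ∈ E.circuit T a t, ∀ h ∈ C, E.Unlocked M T a h t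

/-- The final outcome: the arcs whose asset is redeemed.  All other escrowed assets are
refunded when their circuits can no longer become true. -/
def outcome : Digr V := {a ∈ M.G | ∃ t, E.TriggeredAt M T a t}

/-- The selected set `S_c`: the proposed schemes for which all redundancy providers vote. -/
def selected : Set (Scheme V) :=
  {σ ∈ M.schemes | σ ∈ E.proposal ∧ ∀ y, M.RedundancyProvider y → σ ∈ E.votes y}

/-- By time `t`, `x` has received all incoming escrows in the scheme `σ`. -/
def Received (x : V) (σ : Scheme V) (t : ℕ) : Prop :=
  ∀ b ∈ inc σ.graph x, M.locks σ ∈ E.circuit T b t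

/-- `x` may proceed to redeem the selected scheme `σ`: for every hashlock that `x` generated
for `σ`, and every scheme using this hashlock, `x` has received all incoming escrows. -/
def Proceeds (x : V) (σ : Scheme V) : Prop :=
  σ ∈ E.selected M ∧ ∀ θ : Secret V, θ.owner = x → Hashlock.hash θ ∈ M.locks σ →
    ∀ τ ∈ M.schemes, Hashlock.hash θ ∈ M.locks τ → E.Received M T x τ T.escrowEnd

/-- `x` is to release its secret `θ`. -/
def Releases (x : V) (θ : Secret V) : Prop :=
  θ.owner = x ∧ ∃ σ, E.Proceeds M T x σ ∧ Hashlock.hash θ ∈ M.locks σ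

/-- Signatures of `x` cannot be forged: if a message signed by `x` is part of what anyone
sends, then `x` itself has made this signature, in a hashkey that it sent before. -/
def Unforgeable (x : V) : Prop :=
  ∀ t y a k, Tx.hashkey a k ∈ E.log t y → ∀ m, Occurs (Msg.sig m x) k.sigma →
    ∃ t' ≤ t, ∃ b k', Tx.hashkey b k' ∈ E.log t' x ∧ k'.sigma = Msg.sig m x

/-- `x` conforms to ProtocolA. -/
structure Conforming (x : V) : Prop where
  /-- `x` escrows only for schemes it takes part in, with their hashlocks; unless it is a
  leader of the scheme, only after receiving all incoming escrows of the scheme. -/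
  escrow_only : ∀ t a C, Tx.escrow a C ∈ E.log t x →
    ∃ σ ∈ M.schemes, a ∈ out σ.graph x ∧ C = M.locks σ ∧
      (M.IsLeaderIn x σ ∨ E.Received M T x σ t)
  /-- `x` escrows within `Δ` once it may, if the escrow phase lasts that long. -/
  escrow_due : ∀ σ ∈ M.schemes, ∀ t, (M.IsLeaderIn x σ ∨ E.Received M T x σ t) →
    t + T.Δ ≤ T.escrowEnd → ∀ a ∈ out σ.graph x,
      ∃ t' ≤ t + T.Δ, Tx.escrow a (M.locks σ) ∈ E.log t' x
  /-- As a redundancy provider, `x` votes for compatible schemes only. -/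
  vote : M.RedundancyProvider x → M.Compatible {σ ∈ M.schemes | σ ∈ E.proposal ∧ σ ∈ E.votes x}
  /-- `x` sends hashkeys only in the redeem phase and only to its incoming arcs: either to
  release a secret, or to pass on a hashkey accepted on one of its outgoing arcs. -/
  hashkey_only : ∀ t b k, Tx.hashkey b k ∈ E.log t x →
    T.redeemStart ≤ t ∧ b ∈ inc M.G x ∧
      ((∃ θ, E.Releases M T x θ ∧ k = releaseKey x θ) ∨
        ∃ a ∈ out M.G x, ∃ t' ≤ t, ∃ k', E.Accepts M T a k' t' ∧ x ∉ k'.path ∧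
          k = relayKey x k')
  /-- `x` releases the secrets it is to release, on all incoming arcs with this hashlock. -/
  release_due : ∀ θ, E.Releases M T x θ → ∀ b ∈ inc M.G x,
    (∃ C ∈ E.circuit T b T.escrowEnd, Hashlock.hash θ ∈ C) →
      ∃ t, T.redeemStart ≤ t ∧ t ≤ T.redeemStart + T.Δ ∧
        Tx.hashkey b (releaseKey x θ) ∈ E.log t x
  /-- When a hashkey is accepted on an outgoing arc, `x` passes it on within `Δ` (counted from
  the start of the redeem phase, if it comes earlier) to all incoming arcs with this hashlock,
  except those that are unlocked already. -/
  relay_due : ∀ a ∈ out M.G x, ∀ t k, E.Accepts M T a k t → x ∉ k.path → ∀ b ∈ inc M.G x,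
    (∃ C ∈ E.circuit T b T.escrowEnd, Hashlock.hash k.secret ∈ C) →
      ∃ t', T.redeemStart ≤ t' ∧ t' ≤ max t T.redeemStart + T.Δ ∧
        (Tx.hashkey b (relayKey x k) ∈ E.log t' x ∨
          E.Unlocked M T b (Hashlock.hash k.secret) t')

end Execution

end ProtocolA

namespace ProtocolA

variable {V : Type*}

/-! ### Paths of `T(S)` and their hashlocks -/

/-! Only `x` extends the circuits of its outgoing arcs, so a triggered one was escrowed for a scheme
whose conjunction is unlocked there (`exists_triggeredFor`). Unforgeability makes every accepted
hashkey whose path visits `x` stem from a release or a relay by `x` (`origin_of_mem_path`); in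
particular, secrets of `x` are usable only if released.

Income: the incoming arcs of that scheme carry its conjunction (`received`), and each hashlock
unlocked on the paid arc is passed on to them in time (`unlocked_inc`). So they are all triggered,
and the scheme's graph, being a solution, yields the income.

Cap: if `x` is no redundancy provider, the solutions it pays for have a safe union by definition. If
it is one, its hashlock for the layer that adds the paid arc was unlocked, hence released, so the
arc lies in a selected scheme (`mem_unionGraph_selected`), and the selected schemes are among the
compatible ones for which `x` voted. -/

theorem exists_mem_layer (q : List (Digr V)) (a : Arc V) (i : ℕ) (ha : a ∈ solAt q i) :
    ∃ j ≤ i, a ∈ solAt q j \ prevAt q j := by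
  induction i with
  | zero => exact ⟨0, le_rfl, ha, fun h => h⟩
  | succ i ih =>
    by_cases h : a ∈ solAt q i
    · obtain ⟨j, hj, haj⟩ := ih h
      exact ⟨j, hj.trans i.le_succ, haj⟩
    · exact ⟨i + 1, le_rfl, ha, h⟩

namespace Market

variable {M : Market V}

theorem mem_locksAt {q : List (Digr V)} {h : Hashlock V} {i : ℕ} :
    h ∈ M.locksAt q i ↔ ∃ j ≤ i, h ∈ M.newLocks (prevAt q j) (solAt q j) := by
  induction i with
  | zero => simp [locksAt, prevAt]
  | succ i ih =>
    simp only [locksAt, Set.mem_union, ih]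
    constructor
    · rintro (⟨j, hj, hm⟩ | hm)
      · exact ⟨j, hj.trans i.le_succ, hm⟩
      · exact ⟨i + 1, le_rfl, hm⟩
    · rintro ⟨j, hj, hm⟩
      rcases Nat.le_succ_iff.mp hj with hj | rfl
      · exact Or.inl ⟨j, hj, hm⟩
      · exact Or.inr hm

theorem hash_mem_locks {σ : Scheme V} {y : V} {j : ℕ} (hj : j ≤ σ.idx)
    (hy : y ∈ M.generators (prevAt σ.path j) (solAt σ.path j)) :
    Hashlock.hash ⟨y, prevAt σ.path j, solAt σ.path j⟩ ∈ M.locks σ :=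
  mem_locksAt.mpr ⟨j, hj, y, hy, rfl⟩

theorem IsPath.covers {q : List (Digr V)} (hq : M.IsPath q) {i : ℕ} (hi : i + 1 < q.length) :
    Covers M.sols (solAt q i) (solAt q (i + 1)) := by
  have h := List.isChain_iff_getElem.mp hq.2.1 i hi
  rwa [solAt, solAt, List.getD_eq_getElem _ _ hi,
    List.getD_eq_getElem _ _ (i.lt_succ_self.trans hi)]

theorem IsPath.solAt_mem {q : List (Digr V)} (hq : M.IsPath q) {i : ℕ} (hi : i < q.length) :
    solAt q i ∈ M.sols := by
  cases i with
  | zero =>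
    refine (hq.2.2.1 (solAt q 0) ?_).1
    rw [solAt, List.getD_eq_getElem _ _ hi, List.head?_eq_getElem?, List.getElem?_eq_getElem hi]
    rfl
  | succ i => exact (hq.covers hi).2.1

/-- The bound on `i` matters: past the end of the path, `solAt` is `∅`. -/
theorem IsPath.solAt_subset {q : List (Digr V)} (hq : M.IsPath q) {j i : ℕ} (hji : j ≤ i)
    (hi : i < q.length) : solAt q j ⊆ solAt q i := by
  induction i, hji using Nat.le_induction with
  | base => exact subset_rfl
  | succ i _ ih => exact (ih (i.lt_succ_self.trans hi)).trans (hq.covers hi).2.2.1.subset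

theorem graph_mem_sols {σ : Scheme V} (hσ : σ ∈ M.schemes) : σ.graph ∈ M.sols :=
  hσ.1.solAt_mem hσ.2

/-- A scheme that uses a hashlock of the layer `s \ b` includes `s`. -/
theorem target_subset_graph {σ : Scheme V} (hσ : σ ∈ M.schemes) {θ : Secret V}
    (h : Hashlock.hash θ ∈ M.locks σ) : θ.target ⊆ σ.graph := by
  obtain ⟨j, hj, y, -, he⟩ := mem_locksAt.mp h
  -- `Hashlock.hash` is free, so the hashlock determines its layer, whatever path it is used on.
  cases he
  exact hσ.1.solAt_subset hj hσ.2

end Market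

/-! ### Path signatures -/

theorem pathSig_inj {θ θ' : Secret V} {p p' : List V} (h : pathSig θ p = pathSig θ' p') :
    θ = θ' ∧ p = p' := by
  induction p generalizing p' with
  | nil => cases p' <;> simp_all [pathSig]
  | cons u p ih =>
    cases p' with
    | nil => simp [pathSig] at h
    | cons u' p' =>
      simp only [pathSig, Msg.sig.injEq] at h
      obtain ⟨hθ, hp⟩ := ih h.1
      exact ⟨hθ, by rw [h.2, hp]⟩

/-- Signing starts at the end of the path, so the signature of `y` wraps exactly that of the part
behind `y`. This ties a visit of the path to unforgeability. -/
theorem occurs_pathSig_append (θ : Secret V) (l p : List V) (y : V) :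
    Occurs (Msg.sig (pathSig θ p) y) (pathSig θ (l ++ y :: p)) := by
  induction l with
  | nil => exact Or.inl rfl
  | cons u l ih => exact Or.inr ih

theorem Hashkey.WellFormed.relayKey {G : Digr V} {a b : Arc V} {x : V} {k : Hashkey V}
    (hk : k.WellFormed G a) (ha : a ∈ out G x) (hb : b.2 = x) (hx : x ∉ k.path) :
    (relayKey x k).WellFormed G b := by
  obtain ⟨hc, hn, hh, hl, hs⟩ := hk
  refine ⟨?_, List.nodup_cons.mpr ⟨hx, hn⟩, by simp [ProtocolA.relayKey, hb], ?_, ?_⟩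
  · refine hc.cons fun y hy => ?_
    rw [hh] at hy
    cases hy
    rw [← ha.2]
    exact ha.1
  · simp [ProtocolA.relayKey, List.getLast?_cons, hl]
  · simp [ProtocolA.relayKey, pathSig, hs]

theorem wellFormed_releaseKey (G : Digr V) {b : Arc V} {x : V} {θ : Secret V} (hb : b.2 = x)
    (hθ : θ.owner = x) : (releaseKey x θ).WellFormed G b := by
  simp [Hashkey.WellFormed, releaseKey, pathSig, hb, hθ]

/-! ### Circuits, and how unlocking propagates through a conforming party -/

namespace Execution

variable {M : Market V} {T : Timing} {E : Execution V} {x : V}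

theorem circuit_mono (a : Arc V) {t t' : ℕ} (h : t ≤ t') : E.circuit T a t ⊆ E.circuit T a t' :=
  fun _ ⟨s, hs, h'⟩ => ⟨s, hs.trans h, h'⟩

theorem circuit_subset_escrowEnd (a : Arc V) (t : ℕ) :
    E.circuit T a t ⊆ E.circuit T a T.escrowEnd :=
  fun _ ⟨s, _, hs, h⟩ => ⟨s, hs, hs, h⟩

theorem Unlocked.exists_accepts {a : Arc V} {θ : Secret V} {t : ℕ}
    (h : E.Unlocked M T a (Hashlock.hash θ) t) :
    ∃ t' k, E.Accepts M T a k t' ∧ k.secret = θ := by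
  obtain ⟨t', -, k, hk, he⟩ := h
  exact ⟨t', k, hk, by simpa using he⟩

/-- Unlocking takes place before a time that is the same for all hashlocks. -/
theorem Unlocked.le_deadline [Finite V] {a : Arc V} {h : Hashlock V} {t : ℕ}
    (hu : E.Unlocked M T a h t) :
    E.Unlocked M T a h (T.redeemStart + Nat.card V * T.Δ) := by
  have := Fintype.ofFinite V
  obtain ⟨t', -, k, hk, he⟩ := hu
  refine ⟨t', hk.2.2.2.2.trans ?_, k, hk, he⟩
  -- A path without repetition has at most `Nat.card V` vertices, which bounds every timeout.
  have := hk.2.2.1.2.1.length_le_card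
  rw [Nat.card_eq_fintype_card]
  gcongr

/-- A hashkey accepted on some arc whose path visits `x` stems from `x`: either `x` released
the secret, or `x` relayed a hashkey for it that was accepted on one of its outgoing arcs. -/
theorem Conforming.origin_of_mem_path (hx : E.Conforming M T x) (hsig : E.Unforgeable x)
    {a : Arc V} {k : Hashkey V} {t : ℕ} (hk : E.Accepts M T a k t) (hxk : x ∈ k.path) :
    E.Releases M T x k.secret ∨
      (k.secret.owner ≠ x ∧ ∃ a' ∈ out M.G x, ∃ t' k', E.Accepts M T a' k' t' ∧ x ∉ k'.path ∧
        k'.secret = k.secret) := by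
  obtain ⟨l, p, hp⟩ := List.append_of_mem hxk
  obtain ⟨⟨y, hy⟩, -, ⟨-, -, -, -, hs⟩, -⟩ := hk
  obtain ⟨t₁, -, b, k₁, hk₁, hσ⟩ := hsig t y a k hy (pathSig k.secret p)
    (by rw [hs, hp]; exact occurs_pathSig_append _ _ _ _)
  obtain ⟨-, -, ⟨θ, hθ, rfl⟩ | ⟨a', ha', t', -, k', hk', hxk', rfl⟩⟩ :=
    hx.hashkey_only _ _ _ hk₁
  · simp only [releaseKey, Msg.sig.injEq, and_true] at hσ
    -- The bare secret that `x` signed is the path signature of the empty path.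
    have := (pathSig_inj (p := []) hσ).1
    exact Or.inl (this ▸ hθ)
  · simp only [relayKey, Msg.sig.injEq, and_true] at hσ
    rw [hk'.2.2.1.2.2.2.2] at hσ
    have he := (pathSig_inj hσ).1
    -- The path of `k'` ends at the owner of the secret but avoids `x`.
    refine Or.inr ⟨fun ho => hxk' ?_, a', ha', t', k', hk', hxk', he⟩
    have hl := hk'.2.2.1.2.2.2.1
    rw [he, ho] at hl
    exact List.mem_of_getLast? hl

/-- A secret of `x` can be used on any arc only if `x` released it. -/
theorem Conforming.releases_of_unlocked (hx : E.Conforming M T x) (hsig : E.Unforgeable x)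
    {a : Arc V} {θ : Secret V} {t : ℕ} (hθ : θ.owner = x)
    (h : E.Unlocked M T a (Hashlock.hash θ) t) : E.Releases M T x θ := by
  obtain ⟨t', k, hk, rfl⟩ := h.exists_accepts
  rcases hx.origin_of_mem_path hsig hk (hθ ▸ List.mem_of_getLast? hk.2.2.1.2.2.2.1) with h | h
  · exact h
  · exact absurd hθ h.1

theorem Conforming.unlocked_of_releases (hx : E.Conforming M T x) {θ : Secret V}
    (hθ : E.Releases M T x θ) {b : Arc V} (hb : b ∈ inc M.G x)
    (hC : ∃ C ∈ E.circuit T b T.escrowEnd, Hashlock.hash θ ∈ C) :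
    ∃ t, E.Unlocked M T b (Hashlock.hash θ) t := by
  obtain ⟨t, h₀, h₁, ht⟩ := hx.release_due θ hθ b hb hC
  obtain ⟨C, hC, hm⟩ := hC
  exact ⟨t, t, le_rfl, releaseKey x θ, ⟨⟨x, ht⟩, hb.1, wellFormed_releaseKey _ hb.2 hθ.1,
    ⟨C, circuit_mono b (T.escrowEnd_le.trans h₀) hC, hm⟩, by simpa [releaseKey] using h₁⟩, rfl⟩

theorem Conforming.unlocked_of_accepts (hx : E.Conforming M T x) {a : Arc V}
    (ha : a ∈ out M.G x) {k : Hashkey V} {t : ℕ} (hk : E.Accepts M T a k t) (hxk : x ∉ k.path)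
    {b : Arc V} (hb : b ∈ inc M.G x)
    (hC : ∃ C ∈ E.circuit T b T.escrowEnd, Hashlock.hash k.secret ∈ C) :
    ∃ t, E.Unlocked M T b (Hashlock.hash k.secret) t := by
  obtain ⟨t', h₀, h₁, ht | ht⟩ := hx.relay_due a ha t k hk hxk b hb hC
  · obtain ⟨C, hC, hm⟩ := hC
    refine ⟨t', t', le_rfl, relayKey x k, ⟨⟨x, ht⟩, hb.1, hk.2.2.1.relayKey ha hb.2 hxk,
      ⟨C, circuit_mono b (T.escrowEnd_le.trans h₀) hC, hm⟩, h₁.trans ?_⟩, rfl⟩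
    -- The relay costs `Δ` and adds one vertex, which extends the timeout by `Δ`; the `max` covers
    -- keys accepted before the redeem phase.
    have := max_le hk.2.2.2.2 (Nat.le_add_right T.redeemStart (k.path.length * T.Δ))
    simp only [relayKey, List.length_cons, Nat.add_mul, one_mul]
    omega
  · exact ⟨t', ht⟩

/-- A hashlock unlocked on an outgoing arc of `x` gets unlocked on each incoming arc of `x`
that has it. -/
theorem Conforming.unlocked_inc (hx : E.Conforming M T x) (hsig : E.Unforgeable x)
    {a b : Arc V} (ha : a ∈ out M.G x) (hb : b ∈ inc M.G x) {θ : Secret V} {t : ℕ}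
    (h : E.Unlocked M T a (Hashlock.hash θ) t)
    (hC : ∃ C ∈ E.circuit T b T.escrowEnd, Hashlock.hash θ ∈ C) :
    ∃ t, E.Unlocked M T b (Hashlock.hash θ) t := by
  obtain ⟨t', k, hk, rfl⟩ := h.exists_accepts
  -- If the path visits `x`, the key cannot be relayed again, but `x` has already released the
  -- secret or can relay an earlier key, possibly from another outgoing arc.
  by_cases hxk : x ∈ k.path
  · rcases hx.origin_of_mem_path hsig hk hxk with hr | ⟨-, a', ha', t', k', hk', hxk', he⟩
    · exact hx.unlocked_of_releases hr hb hC
    · rw [← he] at hC ⊢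
      exact hx.unlocked_of_accepts ha' hk' hxk' hb hC
  · exact hx.unlocked_of_accepts ha hk hxk hb hC

/-! ### Schemes for which a conforming party pays -/

/-- The outgoing arc `a` of `x` is escrowed for the scheme `σ`, and the conjunction of `σ` is
unlocked on it. -/
structure TriggeredFor (M : Market V) (T : Timing) (E : Execution V) (x : V) (a : Arc V)
    (σ : Scheme V) : Prop where
  scheme : σ ∈ M.schemes
  mem_out : a ∈ out σ.graph x
  unlocked : ∀ h ∈ M.locks σ, ∃ t, E.Unlocked M T a h t
  escrow : M.IsLeaderIn x σ ∨ E.Received M T x σ T.escrowEnd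

theorem Conforming.exists_triggeredFor (hx : E.Conforming M T x) {a : Arc V}
    (ha : a ∈ out (E.outcome M T) x) : ∃ σ, E.TriggeredFor M T x a σ := by
  obtain ⟨⟨-, t, C, ⟨t', -, -, hesc⟩, hu⟩, rfl⟩ := ha
  obtain ⟨σ, hσ, hout, rfl, hr⟩ := hx.escrow_only _ _ _ hesc
  exact ⟨σ, hσ, hout, fun h hh => ⟨t, hu h hh⟩,
    hr.imp_right fun hr b hb => circuit_subset_escrowEnd b _ (hr b hb)⟩

namespace TriggeredFor

variable {a : Arc V} {σ : Scheme V}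

theorem isSolution (h : E.TriggeredFor M T x a σ) : IsSolution M.G M.req σ.graph :=
  M.sols_valid _ (Market.graph_mem_sols h.scheme)

theorem mem_out_market (h : E.TriggeredFor M T x a σ) : a ∈ out M.G x :=
  ⟨h.isSolution.subset h.mem_out.1, h.mem_out.2⟩

theorem releases (h : E.TriggeredFor M T x a σ) (hx : E.Conforming M T x)
    (hsig : E.Unforgeable x) {θ : Secret V} (hθ : θ.owner = x)
    (hm : Hashlock.hash θ ∈ M.locks σ) : E.Releases M T x θ := by
  obtain ⟨t, ht⟩ := h.unlocked _ hm
  exact hx.releases_of_unlocked hsig hθ ht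

/-- A leader may escrow first, but its own hashlock is in the conjunction. Once that is unlocked,
`x` has released the secret, which requires the incoming escrows of every scheme using it, `σ`
included. -/
theorem received (h : E.TriggeredFor M T x a σ) (hx : E.Conforming M T x)
    (hsig : E.Unforgeable x) : E.Received M T x σ T.escrowEnd := by
  rcases h.escrow with ⟨j, hj, hl⟩ | hr
  · have hm := Market.hash_mem_locks hj (Or.inl hl)
    obtain ⟨hθ, τ, hτ, hmτ⟩ := h.releases hx hsig rfl hm
    exact hτ.2 _ hθ hmτ σ h.scheme hm
  · exact hr

/-- If `x` pays for a scheme, then all its incoming arcs in this scheme are triggered. -/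
theorem inc_subset_outcome [Finite V] (h : E.TriggeredFor M T x a σ) (hx : E.Conforming M T x)
    (hsig : E.Unforgeable x) : inc σ.graph x ⊆ inc (E.outcome M T) x := by
  intro b hb
  have hbG : b ∈ inc M.G x := ⟨h.isSolution.subset hb.1, hb.2⟩
  have hC := h.received hx hsig b hb
  -- Triggering needs one time at which all hashlocks are unlocked: the common deadline.
  refine ⟨⟨hbG.1, T.redeemStart + Nat.card V * T.Δ, M.locks σ, ?_, fun l hl => ?_⟩, hb.2⟩
  · exact circuit_mono b (T.escrowEnd_le.trans (Nat.le_add_right _ _)) hC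
  · obtain ⟨t, ht⟩ := h.unlocked l hl
    obtain ⟨t', ht'⟩ := hx.unlocked_inc hsig h.mem_out_market hbG (θ := l.preimage) ht ⟨_, hC, hl⟩
    exact ht'.le_deadline

/-- A redundancy provider pays only on arcs of selected schemes. -/
theorem mem_unionGraph_selected (h : E.TriggeredFor M T x a σ) (hx : E.Conforming M T x)
    (hsig : E.Unforgeable x) (hrp : M.RedundancyProvider x) :
    a ∈ unionGraph (E.selected M) := by
  obtain ⟨j, hj, ha⟩ := exists_mem_layer σ.path a σ.idx h.mem_out.1
  have hm := Market.hash_mem_locks (M := M) hj (Or.inr ⟨⟨a, ha, Or.inl h.mem_out.2⟩, hrp⟩)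
  obtain ⟨-, τ, hτ, hmτ⟩ := h.releases hx hsig rfl hm
  -- The selected `τ` may differ from `σ`, but sharing the hashlock makes it include the layer's
  -- target, which contains `a`.
  exact Set.mem_biUnion hτ.1 (Market.target_subset_graph hτ.1.1 hmτ ha.1)

end TriggeredFor

/-! ### Not overpaying, and sufficient income -/

theorem Conforming.cap_outcome (hx : E.Conforming M T x) (hsig : E.Unforgeable x) :
    (M.req x).cap (out (E.outcome M T) x) := by
  by_cases hrp : M.RedundancyProvider x
  · refine (M.req x).cap_anti _ _ (fun a ha => ?_) (hx.vote hrp x).2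
    obtain ⟨σ, hσ⟩ := hx.exists_triggeredFor ha
    refine ⟨Set.biUnion_subset_biUnion_left ?_ (hσ.mem_unionGraph_selected hx hsig hrp), ha.2⟩
    exact fun τ hτ => ⟨hτ.1, hτ.2.1, hτ.2.2 x hrp⟩
  -- The triggered arc itself shows that `x` is involved in each of these solutions, so an unsafe
  -- union would make `x` a redundancy provider.
  · have hsafe : Safe M.G (M.req x) x (⋃₀ {s | ∃ a σ, E.TriggeredFor M T x a σ ∧ σ.graph = s}) := by
      by_contra hs
      refine hrp ⟨_, ?_, ?_, hs⟩
      · rintro _ ⟨a, σ, hσ, rfl⟩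
        exact Market.graph_mem_sols hσ.scheme
      · rintro _ ⟨a, σ, hσ, rfl⟩
        exact ⟨a, hσ.mem_out.1, Or.inl hσ.mem_out.2⟩
    refine (M.req x).cap_anti _ _ (fun a ha => ?_) hsafe.2
    obtain ⟨σ, hσ⟩ := hx.exists_triggeredFor ha
    exact ⟨⟨_, ⟨a, σ, hσ, rfl⟩, hσ.mem_out.1⟩, ha.2⟩

theorem Conforming.income_outcome [Finite V] (hx : E.Conforming M T x) (hsig : E.Unforgeable x)
    {γ : Arc V} (hγ : γ ∈ out (E.outcome M T) x) :
    (M.req x).income γ (inc (E.outcome M T) x) := by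
  obtain ⟨σ, hσ⟩ := hx.exists_triggeredFor hγ
  exact (M.req x).income_mono _ _ _ (hσ.inc_subset_outcome hx hsig)
    ((hσ.isSolution.safe x).1 γ hσ.mem_out_market hσ.mem_out.1)

end Execution

end ProtocolA

theorem mainTheorem1 {V : Type*} [Finite V] (M : ProtocolA.Market V) (T : ProtocolA.Timing)
    (E : ProtocolA.Execution V) (x : V)
    (hsig : E.Unforgeable x) (hx : E.Conforming M T x) :
    ((∃ γ ∈ ProtocolA.out M.G x, γ ∈ E.outcome M T) →
        ProtocolA.Live M.G (M.req x) x (E.outcome M T)) ∧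
      ProtocolA.Safe M.G (M.req x) x (E.outcome M T) := by
  have hsafe : ProtocolA.Safe M.G (M.req x) x (E.outcome M T) :=
    ⟨fun γ hγ h => hx.income_outcome hsig ⟨h, hγ.2⟩, hx.cap_outcome hsig⟩
  exact ⟨fun ⟨γ, hγ, h⟩ => ⟨hsafe, γ, hγ, hx.income_outcome hsig ⟨h, hγ.2⟩⟩, hsafe⟩
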